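/- Let $X$ be a connected smooth manifold of dimension $2$ (without boundary) with $H_1(X,\mathbb{Z})=0$ (singular homology), and let $F\colon X\to\mathbb{R}^2$ be a smooth local diffeomorphism. Let $D\subset\mathbb{R}^2$ be a finite set such that the restriction $F\colon X\setminus F^{-1}(D)\to\mathbb{R}^2\setminus D$ is a $d$-sheeted cover, i.e. a covering map all of whose fibres have exactly $d$ points, where $d$ is a natural number or $\infty$ (meaning that the fibres are infinite). Then $d=1$ or $d=\infty$. -/

import Mathlib

open scoped Manifold ContDiff

universe u

/-- A `d`-sheeted cover: a covering map all of whose fibres have exactly `d` points, where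
`d` is a natural number or `⊤` (infinitely many sheets). -/
def IsSheetedCover {E B : Type*} [TopologicalSpace E] [TopologicalSpace B]
    (f : E → B) (d : ℕ∞) : Prop :=
  IsCoveringMap f ∧ ∀ b : B, (f ⁻¹' {b}).encard = d

/-- The singular homology group `H_k(X, ℤ)`. The coefficient group `ℤ` is lifted to the
universe of `X`. -/
noncomputable def integralHomology (k : ℕ) (X : Type u) [TopologicalSpace X] :
    ModuleCat.{u} ℤ :=
  ((AlgebraicTopology.singularHomologyFunctor (ModuleCat.{u} ℤ) k).obj
    (ModuleCat.of ℤ (ULift.{u} ℤ))).obj (TopCat.of X)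

/-! Only a finite d = n needs an argument. It suffices that every fibre over D has exactly n points:
then F is a covering of the simply connected plane by a connected space, so n = 1. A fibre has at
most n points because fibres of a local homeomorphism cannot get smaller at nearby points.

For at least n, move the puncture p to 0 so that the other points of D avoid the punctured unit disc
and a sector around the positive axis. This region is the image under `exp` of a keyhole, which is
contractible, so every y over exp(-1) extends to a lift s of `exp`. Suppose the sheet of s over the
sector has no limit point over 0. Then a narrower closed sheet is closed in X, and a map to the
circle that winds once across it and is constant elsewhere is continuous. A circle around 0, lifted
until its first return to y, crosses this sheet once, so the map has degree one on a loop; H₁ = 0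
forbids this (`circle_lift_eq_of_subsingleton_homology`). So the sheet has a limit point over 0. The
local inverse of F there determines y (`IsExpLift.eq_of_mem_closure`), which injects the fibre over
exp(-1) into the fibre over 0. -/

/-! ### Vanishing first homology and maps to the circle -/

open CategoryTheory Limits Simplicial in
/-- On a simplicial set with vanishing first homology, every real `1`-cocycle vanishes on loops. -/
theorem SSet.cocycle_eq_zero_of_subsingleton_homology (S : SSet.{u})
    (hS : Subsingleton
      ((S.chainComplex (ModuleCat.of ℤ (ULift.{u} ℤ))).homology 1 : ModuleCat.{u} ℤ))
    (φ : S _⦋1⦌ → ℝ)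
    (hφ : ∀ x : S _⦋2⦌, φ (S.δ 0 x) - φ (S.δ 1 x) + φ (S.δ 2 x) = 0)
    (γ : S _⦋1⦌) (hγ : S.δ 0 γ = S.δ 1 γ) : φ γ = 0 := by
  set R : ModuleCat.{u} ℤ := ModuleCat.of ℤ (ULift.{u} ℤ)
  set K := S.chainComplex R
  have hex : K.ExactAt 1 := by
    rw [HomologicalComplex.exactAt_iff_isZero_homology]
    exact ModuleCat.isZero_of_subsingleton _
  rw [K.exactAt_iff' 2 1 0 (by simp) (by simp), ShortComplex.moduleCat_exact_iff] at hex
  have hcyc : (K.d 1 0).hom ((S.ιChainComplex (R := R) γ).hom ⟨1⟩) = 0 := by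
    have h := S.ιChainComplex_d (R := R) γ
    have h2 : S.ιChainComplex (R := R) γ ≫ K.d 1 0 = 0 := by
      refine h.trans ?_
      simp [Fin.sum_univ_two, hγ]
    exact congrArg (fun f => f.hom ⟨1⟩) h2
  obtain ⟨y, hy⟩ := hex _ hcyc
  let ev : S _⦋1⦌ → (R ⟶ ModuleCat.of ℤ (ULift.{u} ℝ)) := fun x =>
    ModuleCat.ofHom ((LinearMap.toSpanSingleton ℤ (ULift.{u} ℝ) ⟨φ x⟩).comp
      (ULift.moduleEquiv (R := ℤ) (M := ℤ)).toLinearMap)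
  have hev : ∀ x (n : ULift.{u} ℤ), (ev x).hom n = ⟨n.down * φ x⟩ := fun x n => by
    ext; simp [ev, ULift.moduleEquiv]; exact Or.inl rfl
  -- The linear extension of φ to 1-chains. It kills boundaries by `hφ`, and γ, being a cycle, is a
  -- boundary.
  let Φ : K.X 1 ⟶ ModuleCat.of ℤ (ULift.{u} ℝ) := Sigma.desc ev
  have hι : ∀ x, S.ιChainComplex (R := R) x ≫ Φ = ev x := fun x => Sigma.ι_desc _ _
  have hd : K.d 2 1 ≫ Φ = 0 := by
    refine Sigma.hom_ext _ _ fun x => ?_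
    have h : S.ιChainComplex (R := R) x ≫ K.d 2 1 = S.ιChainComplex (S.δ 0 x) -
        S.ιChainComplex (S.δ 1 x) + S.ιChainComplex (S.δ 2 x) := by
      refine (S.ιChainComplex_d (R := R) x).trans ((Fin.sum_univ_three _).trans ?_)
      simp [sub_eq_add_neg]
    change S.ιChainComplex (R := R) x ≫ K.d 2 1 ≫ Φ = S.ιChainComplex (R := R) x ≫ 0
    rw [← Category.assoc, h, Preadditive.add_comp, Preadditive.sub_comp, hι, hι, hι, comp_zero]
    ext a
    simp only [ModuleCat.hom_add, ModuleCat.hom_sub, ModuleCat.hom_zero, LinearMap.add_apply,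
      LinearMap.sub_apply, LinearMap.zero_apply, hev, ULift.add_down, ULift.sub_down,
      ULift.zero_down]
    linear_combination a.down * hφ x
  have h1 : Φ.hom ((S.ιChainComplex (R := R) γ).hom ⟨1⟩) = ⟨φ γ⟩ := by
    have := congrArg (fun f => f.hom ⟨1⟩) (hι γ)
    exact this.trans ((hev γ ⟨1⟩).trans (by simp))
  have h2 : Φ.hom ((S.ιChainComplex (R := R) γ).hom ⟨1⟩) = 0 := by
    rw [← hy]
    exact congrArg (fun f => f.hom y) hd
  simpa using congrArg ULift.down (h1.symm.trans h2)

section Homology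

open CategoryTheory Simplicial

theorem stdSimplex.exists_circle_lift (n : ℕ) (f : C(stdSimplex ℝ (Fin (n + 1)), Circle)) :
    ∃ L : C(stdSimplex ℝ (Fin (n + 1)), ℝ), ∀ s, Circle.exp (L s) = f s := by
  have hc := convex_stdSimplex ℝ (Fin (n + 1))
  have := hc.locallyPathConnectedSpace
  have := hc.contractibleSpace ⟨_, (stdSimplex.vertex (S := ℝ) (0 : Fin (n + 1))).2⟩
  have : SimplyConnectedSpace (stdSimplex ℝ (Fin (n + 1))) := inferInstance
  let v := stdSimplex.vertex (S := ℝ) (0 : Fin (n + 1))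
  obtain ⟨e, he⟩ := Circle.exp_surjective (f v)
  obtain ⟨L, ⟨-, hL⟩, -⟩ := Circle.isCoveringMap_exp.existsUnique_continuousMap_lifts f v e he
  exact ⟨L, fun s => congrFun hL s⟩

/-- Two lifts to `ℝ` of the same map to the circle have the same increments. -/
theorem Circle.lift_sub_eq_lift_sub {A : Type*} [TopologicalSpace A] [PreconnectedSpace A]
    {L L' : A → ℝ} (hL : Continuous L) (hL' : Continuous L')
    (h : ∀ a, Circle.exp (L a) = Circle.exp (L' a)) (a b : A) : L b - L a = L' b - L' a := by
  have hf : Continuous fun x => L' x + (L a - L' a) := by fun_prop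
  have := Circle.isCoveringMap_exp.eq_of_comp_eq hL hf (by
    funext x
    simp [Circle.exp_add, Circle.exp_sub, h]) a (by simp)
  linarith [congrFun this b]

/-- If `H₁(X, ℤ) = 0`, then a map from `X` to the circle has degree zero along every loop. -/
theorem circle_lift_eq_of_subsingleton_homology {X : Type u} [TopologicalSpace X]
    (hH : Subsingleton (integralHomology 1 X)) (g : C(X, Circle)) (γ : C(unitInterval, X))
    (hγ : γ 0 = γ 1) (u : C(unitInterval, ℝ)) (hu : ∀ t, Circle.exp (u t) = g (γ t)) :
    u 0 = u 1 := by
  let S := TopCat.toSSet.obj (TopCat.of X)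
  let τ (n : ℕ) : S _⦋n⦌ ≃ C(stdSimplex ℝ (Fin (n + 1)), X) :=
    TopCat.toSSetObjEquiv (TopCat.of X) (.op ⦋n⦌)
  have hτ (n : ℕ) (i : Fin (n + 2)) (x : S _⦋n + 1⦌) (s : stdSimplex ℝ (Fin (n + 1))) :
      τ n (S.δ i x) s = τ (n + 1) x (stdSimplex.map i.succAbove s) := rfl
  -- φ is the change of argument of g along a singular edge. It is a cocycle because a lift over a
  -- 2-simplex restricts to lifts over its edges, whose increments telescope.
  choose L hL using fun x : S _⦋1⦌ => stdSimplex.exists_circle_lift 1 (g.comp (τ 1 x))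
  let φ : S _⦋1⦌ → ℝ := fun x => L x (stdSimplex.vertex 1) - L x (stdSimplex.vertex 0)
  have hφ (x : S _⦋1⦌) (M : stdSimplex ℝ (Fin 2) → ℝ) (hM : Continuous M)
      (h : ∀ s, Circle.exp (M s) = g (τ 1 x s)) :
      φ x = M (stdSimplex.vertex 1) - M (stdSimplex.vertex 0) :=
    Circle.lift_sub_eq_lift_sub (L x).continuous hM (fun s => (hL x s).trans (h s).symm) _ _
  have key := SSet.cocycle_eq_zero_of_subsingleton_homology S hH φ (fun x => by
    obtain ⟨M, hM⟩ := stdSimplex.exists_circle_lift 2 (g.comp (τ 2 x))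
    have hi (i : Fin 3) := hφ (S.δ i x) (M ∘ stdSimplex.map i.succAbove)
      (M.continuous.comp (stdSimplex.continuous_map _)) (fun s => hM _)
    rw [hi, hi, hi]
    simp only [Function.comp_apply, stdSimplex.map_vertex]
    simp [Fin.succAbove])
    ((τ 1).symm (γ.comp (toContinuousMap stdSimplexHomeomorphUnitInterval))) (by
      apply (τ 0).injective
      ext s
      rw [hτ, hτ, Equiv.apply_symm_apply, Subsingleton.elim s (stdSimplex.vertex 0),
        stdSimplex.map_vertex, stdSimplex.map_vertex]
      exact hγ.symm)
  rw [hφ _ (u ∘ stdSimplexHomeomorphUnitInterval) (by fun_prop) (fun s => by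
    rw [Equiv.apply_symm_apply]; exact hu _)] at key
  have : u 1 - u 0 = 0 := key
  linarith

end Homology

/-! ### Lifts of the exponential over keyholes -/

open Complex Set Filter Topology

/-- The union of the left half plane and a horizontal strip of half-width `ε`. -/
def keyhole (ε : ℝ) : Set ℂ := {w | w.re < 0 ∨ |w.im| < ε}

theorem isOpen_keyhole (ε : ℝ) : IsOpen (keyhole ε) :=
  (isOpen_lt continuous_re continuous_const).union
    (isOpen_lt (continuous_abs.comp continuous_im) continuous_const)

theorem neg_one_mem_keyhole (ε : ℝ) : (-1 : ℂ) ∈ keyhole ε := Or.inl (by simp)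

theorem starConvex_keyhole (ε : ℝ) : StarConvex ℝ (-1 : ℂ) (keyhole ε) := by
  intro w hw a b ha hb hab
  rcases hb.eq_or_lt with rfl | hb'
  · obtain rfl : a = 1 := by linarith
    simpa using neg_one_mem_keyhole ε
  rcases hw with hw | hw
  · left
    simp only [smul_neg, real_smul, mul_one, add_re, neg_re, ofReal_re, re_ofReal_mul]
    nlinarith [mul_neg_of_pos_of_neg hb' hw]
  · right
    simp only [smul_neg, real_smul, mul_one, add_im, neg_im, ofReal_im, neg_zero, im_ofReal_mul,
      zero_add, abs_mul, abs_of_pos hb']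
    nlinarith [abs_nonneg w.im]

theorem isPreconnected_keyhole (ε : ℝ) : IsPreconnected (keyhole ε) :=
  ((starConvex_keyhole ε).isPathConnected (neg_one_mem_keyhole ε)).isConnected.isPreconnected

section

variable {X : Type*} [TopologicalSpace X] {f : X → ℂ} {ε : ℝ} {s s' : ℂ → X}

/-- A lift along `f` of the exponential map, defined on a keyhole domain. -/
structure IsExpLift (f : X → ℂ) (ε : ℝ) (s : ℂ → X) : Prop where
  continuousOn : ContinuousOn s (keyhole ε)
  map_eq : ∀ w ∈ keyhole ε, f (s w) = exp w

theorem IsCoveringMapOn.exists_isExpLift {S : Set ℂ} (hf : IsCoveringMapOn f S)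
    (hS : ∀ w ∈ keyhole ε, exp w ∈ S) {y : X} (hy : f y = exp (-1)) :
    ∃ s, IsExpLift f ε s ∧ s (-1) = y := by
  have := (isOpen_keyhole ε).locallyPathConnectedSpace
  have := (starConvex_keyhole ε).contractibleSpace ⟨_, neg_one_mem_keyhole ε⟩
  obtain ⟨F, ⟨hF0, hF⟩, -⟩ := hf.existsUnique_continuousMap_lifts
    (⟨fun w => exp w, by fun_prop⟩ : C(keyhole ε, ℂ)) (a₀ := ⟨-1, neg_one_mem_keyhole ε⟩) hy
    (fun a => hS a a.2)
  classical
  have hs : ∀ w (hw : w ∈ keyhole ε), (if h : w ∈ keyhole ε then F ⟨w, h⟩ else y) = F ⟨w, hw⟩ :=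
    fun w hw => by simp [hw]
  refine ⟨fun w => if h : w ∈ keyhole ε then F ⟨w, h⟩ else y, ⟨?_, fun w hw => ?_⟩, ?_⟩
  · rw [continuousOn_iff_continuous_domRestrict]
    convert F.continuous using 1
    ext w
    simp
  · rw [hs w hw]
    exact congrFun hF ⟨w, hw⟩
  · exact (hs _ (neg_one_mem_keyhole ε)).trans hF0

/-- Two lifts of the same map along a local homeomorphism from a Hausdorff space agree on a
preconnected set as soon as they agree at a point. -/
theorem IsLocalHomeomorph.eqOn_lift [T2Space X] (hf : IsLocalHomeomorph f) {A : Type*}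
    [TopologicalSpace A] {P : Set A} (hP : IsPreconnected P) {g g' : A → X}
    (hg : ContinuousOn g P) (hg' : ContinuousOn g' P) (h : ∀ a ∈ P, f (g a) = f (g' a))
    {a : A} (ha : a ∈ P) (haa : g a = g' a) : EqOn g g' P :=
  (T2Space.isSeparatedMap f).eqOn_of_comp_eqOn hf.isLocallyInjective hP hg hg' h ha haa

/-- The part of the sheet of an exponential lift lying over a closed sector. -/
def sheetCore (s : ℂ → X) (ε : ℝ) : Set X := s '' {w | |w.im| ≤ ε / 2}

theorem strip_subset_keyhole : {w : ℂ | |w.im| < ε} ⊆ keyhole ε := fun _ h => Or.inr h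

theorem core_subset_strip (hε : 0 < ε) : {w : ℂ | |w.im| ≤ ε / 2} ⊆ {w : ℂ | |w.im| < ε} :=
  fun w (h : |w.im| ≤ ε / 2) => show |w.im| < ε by linarith

/-- An exponential lift whose sheet accumulates at a point `x` over `0` agrees with the local
inverse of `f` at `x`. -/
theorem IsExpLift.eqOn_localInverse [T2Space X] (hf : IsLocalHomeomorph f) (hε : 0 < ε)
    (hs : IsExpLift f ε s) {x : X} {e : OpenPartialHomeomorph X ℂ} (hxe : x ∈ e.source)
    (hfe : f = e) {ρ : ℝ} (hρ : Metric.ball (0 : ℂ) (Real.exp ρ) ⊆ e.target) (hx0 : f x = 0)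
    (hx : x ∈ closure (sheetCore s ε)) :
    EqOn s (fun w => e.symm (exp w)) {w | w.re < ρ ∧ |w.im| < ε} := by
  have hball : ∀ w : ℂ, exp w ∈ Metric.ball (0 : ℂ) (Real.exp ρ) ↔ w.re < ρ := fun w => by
    rw [mem_ball_zero_iff, norm_exp, Real.exp_lt_exp]
  have hconv : Convex ℝ {w : ℂ | w.re < ρ ∧ |w.im| < ε} := by
    refine (convex_halfSpace_re_lt ρ).inter ?_
    have : {w : ℂ | |w.im| < ε} = {w | -ε < w.im} ∩ {w | w.im < ε} := by
      ext w; exact abs_lt (a := w.im)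
    change Convex ℝ {w : ℂ | |w.im| < ε}
    rw [this]
    exact (convex_halfSpace_im_gt _).inter (convex_halfSpace_im_lt _)
  have hU : e.source ∩ f ⁻¹' Metric.ball 0 (Real.exp ρ) ∈ 𝓝 x :=
    inter_mem (e.open_source.mem_nhds hxe) (hf.continuous.continuousAt.preimage_mem_nhds
      (Metric.isOpen_ball.mem_nhds (by simp [hx0, Real.exp_pos])))
  obtain ⟨-, ⟨hy1, hy2⟩, w, hw, rfl⟩ := mem_closure_iff_nhds.1 hx _ hU
  have hw' := core_subset_strip hε hw
  have hfw := hs.map_eq w (strip_subset_keyhole hw')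
  have hwP : w ∈ {w : ℂ | w.re < ρ ∧ |w.im| < ε} :=
    ⟨(hball w).1 (hfw ▸ hy2), hw'⟩
  refine hf.eqOn_lift hconv.isPreconnected
    (hs.continuousOn.mono fun w h => strip_subset_keyhole h.2) ?_ ?_ hwP ?_
  · exact e.continuousOn_symm.comp continuous_exp.continuousOn
      fun w h => hρ ((hball w).2 h.1)
  · intro a ha
    rw [hs.map_eq a (strip_subset_keyhole ha.2), hfe]
    exact (e.right_inv (hρ ((hball a).2 ha.1))).symm
  · rw [← hfw, hfe]
    exact (e.left_inv hy1).symm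

theorem IsExpLift.eq_of_mem_closure [T2Space X] (hf : IsLocalHomeomorph f) (hε : 0 < ε)
    (hs : IsExpLift f ε s) (hs' : IsExpLift f ε s') {x : X} (hx0 : f x = 0)
    (hx : x ∈ closure (sheetCore s ε)) (hx' : x ∈ closure (sheetCore s' ε)) :
    s (-1) = s' (-1) := by
  obtain ⟨e, hxe, hfe⟩ := hf x
  have h0 : (0 : ℂ) ∈ e.target := by
    rw [← hx0, hfe]; exact e.map_source hxe
  obtain ⟨r, hr, hball⟩ := Metric.isOpen_iff.1 e.open_target 0 h0
  rw [← Real.exp_log hr] at hball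
  have h1 := hs.eqOn_localInverse hf hε hxe hfe hball hx0 hx
  have h2 := hs'.eqOn_localInverse hf hε hxe hfe hball hx0 hx'
  -- Any point of the strip with real part below log r would do: both lifts equal the local inverse
  -- there.
  have hw : ((Real.log r - 1 : ℝ) : ℂ) ∈ {w : ℂ | w.re < Real.log r ∧ |w.im| < ε} :=
    ⟨by rw [ofReal_re]; linarith, by simpa using hε⟩
  exact hf.eqOn_lift (isPreconnected_keyhole ε) hs.continuousOn hs'.continuousOn
    (fun a ha => (hs.map_eq a ha).trans (hs'.map_eq a ha).symm)
    (strip_subset_keyhole hw.2) ((h1 hw).trans (h2 hw).symm) (neg_one_mem_keyhole ε)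

/-- Translation by a period of the exponential maps a lift to a lift over the half plane. -/
theorem IsExpLift.translate_eq [T2Space X] (hf : IsLocalHomeomorph f)
    (hs : IsExpLift f ε s) {m n : ℤ} {w₀ : ℂ} (hw₀ : w₀.re < 0)
    (h : s (w₀ + m * (2 * Real.pi * I)) = s (w₀ + n * (2 * Real.pi * I))) {w : ℂ}
    (hw : w.re < 0) : s (w + m * (2 * Real.pi * I)) = s (w + n * (2 * Real.pi * I)) := by
  have hre : ∀ (k : ℤ) (w : ℂ), (w + k * (2 * Real.pi * I)).re = w.re := fun k w => by simp
  have hmem : ∀ (k : ℤ) (w : ℂ), w.re < 0 → w + k * (2 * Real.pi * I) ∈ keyhole ε :=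
    fun k w hw => Or.inl (by rwa [hre])
  have hc : ∀ k : ℤ, ContinuousOn (fun w : ℂ => s (w + k * (2 * Real.pi * I))) {w | w.re < 0} :=
    fun k => hs.continuousOn.comp (by fun_prop) fun w hw => hmem k w hw
  refine hf.eqOn_lift (convex_halfSpace_re_lt 0).isPreconnected (hc m) (hc n) (fun a ha => ?_)
    hw₀ h hw
  rw [hs.map_eq _ (hmem m a ha), hs.map_eq _ (hmem n a ha), exp_add, exp_add,
    exp_int_mul_two_pi_mul_I, exp_int_mul_two_pi_mul_I]

end

/-! ### Sheets over a sector -/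

/-- The open sector of half-angle `ε` around the positive real axis. -/
def sector (ε : ℝ) : Set ℂ := {z | z ∈ slitPlane ∧ |arg z| < ε}

theorem isOpen_sector (ε : ℝ) : IsOpen (sector ε) := by
  have h : ContinuousOn (fun z => |arg z|) slitPlane := fun z hz =>
    ((continuousAt_arg hz).abs).continuousWithinAt
  exact h.isOpen_inter_preimage isOpen_slitPlane isOpen_Iio

theorem abs_arg_le_iff {z : ℂ} (hz : z ≠ 0) {α : ℝ} (h0 : 0 ≤ α) (hα : α ≤ Real.pi) :
    |arg z| ≤ α ↔ ‖z‖ * Real.cos α ≤ z.re := by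
  have hn : 0 < ‖z‖ := norm_pos_iff.2 hz
  rw [← Real.strictAntiOn_cos.le_iff_ge ⟨h0, hα⟩ ⟨abs_nonneg _, abs_arg_le_pi z⟩, Real.cos_abs,
    cos_arg hz, le_div_iff₀ hn, mul_comm]

theorem log_exp_of_mem_strip {ε : ℝ} (hε : ε < Real.pi) {w : ℂ} (hw : |w.im| < ε) :
    log (exp w) = w := by
  have := abs_lt.1 (hw.trans hε)
  exact log_exp this.1 this.2.le

theorem exp_mem_sector {ε : ℝ} (hε : ε < Real.pi) {w : ℂ} (hw : |w.im| < ε) :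
    exp w ∈ sector ε := by
  have h : arg (exp w) = w.im := by rw [← log_im, log_exp_of_mem_strip hε hw]
  refine ⟨mem_slitPlane_iff_arg.2 ⟨?_, exp_ne_zero w⟩, by rwa [h]⟩
  rw [h]
  exact ((abs_lt.1 (hw.trans hε)).2).ne

section

variable {X : Type*} [TopologicalSpace X] {f : X → ℂ} {ε : ℝ} {s : ℂ → X}

/-- The sheet over an open sector singled out by an exponential lift. -/
def sheet (f : X → ℂ) (s : ℂ → X) (ε : ℝ) : Set X :=
  {x | f x ∈ sector ε ∧ s (log (f x)) = x}

theorem IsExpLift.continuous_section (hf : Continuous f) (hs : IsExpLift f ε s) :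
    Continuous fun x : f ⁻¹' sector ε => s (log (f x)) := by
  refine hs.continuousOn.comp_continuous ?_ fun x => Or.inr (by rw [log_im]; exact x.2.2)
  exact Continuous.clog (by fun_prop) fun x => x.2.1

theorem IsExpLift.map_section (hs : IsExpLift f ε s) {x : X} (hx : f x ∈ sector ε) :
    f (s (log (f x))) = f x := by
  rw [hs.map_eq _ (Or.inr (by rw [log_im]; exact hx.2)), exp_log (slitPlane_ne_zero hx.1)]

/-- The inclusion and `s (log (f x))` are two lifts of f over the sector. They agree on an open set
by local injectivity; that this set is also relatively closed, by the Hausdorff property, is the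
next lemma. -/
theorem IsExpLift.isOpen_sheet (hf : IsLocalHomeomorph f) (hs : IsExpLift f ε s) :
    IsOpen (sheet f s ε) := by
  have h := hf.isLocallyInjective.isOpen_eqLocus (hs.continuous_section hf.continuous)
    continuous_subtype_val (funext fun x => hs.map_section x.2)
  convert ((isOpen_sector ε).preimage hf.continuous).isOpenMap_subtype_val _ h using 1
  ext x
  simp [sheet, and_comm]

theorem IsExpLift.isOpen_sector_diff_sheet [T2Space X] (hf : IsLocalHomeomorph f)
    (hs : IsExpLift f ε s) : IsOpen (f ⁻¹' sector ε \ sheet f s ε) := by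
  have h := (isClosed_eq (hs.continuous_section hf.continuous) continuous_subtype_val).isOpen_compl
  convert ((isOpen_sector ε).preimage hf.continuous).isOpenMap_subtype_val _ h using 1
  ext x
  simp only [sheet, Set.mem_sdiff, mem_preimage, mem_ofPred_eq, not_and, mem_image, mem_compl_iff,
    Subtype.exists, exists_and_right, exists_eq_right]
  exact ⟨fun h => ⟨h.1, h.2 h.1⟩, fun ⟨h1, h2⟩ => ⟨h1, fun _ => h2⟩⟩

theorem IsExpLift.sheetCore_eq (hε : 0 < ε) (hεπ : ε < Real.pi) (hs : IsExpLift f ε s) :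
    sheetCore s ε = sheet f s ε ∩ {x | |arg (f x)| ≤ ε / 2} := by
  ext x
  constructor
  · rintro ⟨w, hw, rfl⟩
    have hw' : |w.im| < ε := core_subset_strip hε hw
    have hlog := log_exp_of_mem_strip hεπ hw'
    have hfw := hs.map_eq w (strip_subset_keyhole hw')
    refine ⟨⟨hfw ▸ exp_mem_sector hεπ hw', by rw [hfw, hlog]⟩, ?_⟩
    rw [mem_ofPred_eq, hfw, ← log_im, hlog]
    exact hw
  · rintro ⟨⟨h1, h2⟩, h3⟩
    exact ⟨log (f x), by rw [mem_ofPred_eq, log_im]; exact h3, h2⟩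

/-- The closed sheet can only accumulate over the apex of the sector. -/
theorem IsExpLift.isClosed_sheetCore [T2Space X] (hf : IsLocalHomeomorph f) (hε : 0 < ε)
    (hεπ : ε < Real.pi) (hs : IsExpLift f ε s)
    (h0 : ∀ x, f x = 0 → x ∉ closure (sheetCore s ε)) : IsClosed (sheetCore s ε) := by
  refine isClosed_of_closure_subset fun x hx => ?_
  have hfx : f x ≠ 0 := fun h => h0 x h hx
  -- `arg` jumps across the negative axis, so the angle bound is rewritten as an inequality between
  -- continuous functions.
  have hcl : IsClosed {x | ‖f x‖ * Real.cos (ε / 2) ≤ (f x).re} := by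
    have := hf.continuous
    exact isClosed_le (by fun_prop) (by fun_prop)
  have hsub : sheetCore s ε ⊆ {x | ‖f x‖ * Real.cos (ε / 2) ≤ (f x).re} := by
    rw [hs.sheetCore_eq hε hεπ]
    rintro y ⟨⟨h1, -⟩, h2⟩
    exact (abs_arg_le_iff (slitPlane_ne_zero h1.1) (by linarith) (by linarith)).1 h2
  have harg : |arg (f x)| ≤ ε / 2 :=
    (abs_arg_le_iff hfx (by linarith) (by linarith)).2 (closure_minimal hsub hcl hx)
  have hsec : f x ∈ sector ε := by
    refine ⟨mem_slitPlane_iff_arg.2 ⟨fun h => ?_, hfx⟩, by linarith⟩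
    rw [h, abs_of_pos Real.pi_pos] at harg
    linarith
  rw [hs.sheetCore_eq hε hεπ]
  refine ⟨by_contra fun hns => ?_, harg⟩
  obtain ⟨y, hy1, hy2⟩ := mem_closure_iff_nhds.1 hx _
    ((hs.isOpen_sector_diff_sheet hf).mem_nhds ⟨hsec, hns⟩)
  rw [hs.sheetCore_eq hε hεπ] at hy2
  exact hy1.2 hy2.1

/-! ### The circle-valued map dual to a sheet -/

/-- The piecewise linear function rising from `0` to `1` on `[-ε / 2, ε / 2]`. -/
noncomputable def ramp (ε θ : ℝ) : ℝ := max 0 (min 1 (θ / ε + 1 / 2))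

theorem continuous_ramp (ε : ℝ) : Continuous (ramp ε) := by
  unfold ramp
  fun_prop

theorem ramp_of_le {θ : ℝ} (hε : 0 < ε) (h : θ ≤ -(ε / 2)) : ramp ε θ = 0 := by
  have : θ / ε + 1 / 2 ≤ 0 := by
    have : θ / ε ≤ -(1 / 2) := by rw [div_le_iff₀ hε]; linarith
    linarith
  exact max_eq_left ((min_le_right _ _).trans this)

theorem ramp_of_ge {θ : ℝ} (hε : 0 < ε) (h : ε / 2 ≤ θ) : ramp ε θ = 1 := by
  have : 1 ≤ θ / ε + 1 / 2 := by
    have : 1 / 2 ≤ θ / ε := by rw [le_div_iff₀ hε]; linarith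
    linarith
  rw [ramp, min_eq_left this]
  norm_num

theorem ramp_zero (ε : ℝ) : ramp ε 0 = 1 / 2 := by
  norm_num [ramp]

theorem circle_exp_two_pi_mul_ramp {θ : ℝ} (hε : 0 < ε) (h : ε / 2 ≤ |θ|) :
    Circle.exp (2 * Real.pi * ramp ε θ) = 1 := by
  rcases le_abs.1 h with h | h
  · simp [ramp_of_ge hε h]
  · simp [ramp_of_le hε (le_neg.1 h)]

open Classical in
/-- The map to the circle that crosses the circle once transversally to the sheet of an
exponential lift and is constant elsewhere. -/
noncomputable def sheetToCircle (f : X → ℂ) (s : ℂ → X) (ε : ℝ) (x : X) : Circle :=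
  if x ∈ sheet f s ε then Circle.exp (2 * Real.pi * ramp ε (arg (f x))) else 1

/-- The open sheet and the complement of the closed core cover X; on the latter the map is
constantly 1. -/
theorem IsExpLift.continuous_sheetToCircle [T2Space X] (hf : IsLocalHomeomorph f) (hε : 0 < ε)
    (hεπ : ε < Real.pi) (hs : IsExpLift f ε s)
    (h0 : ∀ x, f x = 0 → x ∉ closure (sheetCore s ε)) : Continuous (sheetToCircle f s ε) := by
  rw [continuous_iff_continuousAt]
  intro x
  by_cases hx : x ∈ sheet f s ε
  · have h1 : ContinuousAt (fun x => Circle.exp (2 * Real.pi * ramp ε (arg (f x)))) x := by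
      refine Circle.exp.continuous.continuousAt.comp (continuousAt_const.mul ?_)
      exact (continuous_ramp ε).continuousAt.comp
        ((continuousAt_arg hx.1.1).comp hf.continuous.continuousAt)
    refine h1.congr ?_
    filter_upwards [(hs.isOpen_sheet hf).mem_nhds hx] with y hy
    simp [sheetToCircle, hy]
  · have hx' : x ∉ sheetCore s ε := by
      rw [hs.sheetCore_eq hε hεπ]
      exact fun h => hx h.1
    refine (continuousAt_const (y := (1 : Circle))).congr ?_
    filter_upwards [(hs.isClosed_sheetCore hf hε hεπ h0).isOpen_compl.mem_nhds hx'] with y hy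
    by_cases hys : y ∈ sheet f s ε
    · rw [hs.sheetCore_eq hε hεπ] at hy
      have : ε / 2 ≤ |arg (f y)| := by
        by_contra! h
        exact hy ⟨hys, h.le⟩
      simp [sheetToCircle, hys, circle_exp_two_pi_mul_ramp hε this]
    · simp [sheetToCircle, hys]

end

/-! ### The loop around the puncture -/

section

variable {X : Type u} [TopologicalSpace X] {f : X → ℂ} {ε : ℝ} {s : ℂ → X}

/-- If the fibre over the base point is finite, an exponential lift is periodic. -/
theorem IsExpLift.exists_period [T2Space X] (hf : IsLocalHomeomorph f) (hs : IsExpLift f ε s)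
    (hfin : (f ⁻¹' {exp (-1)}).Finite) :
    ∃ k : ℕ, 0 < k ∧ s (-1 + (k : ℤ) * (2 * Real.pi * I)) = s (-1) := by
  have hmem : ∀ n : ℕ, -1 + (n : ℤ) * (2 * Real.pi * I) ∈ keyhole ε := fun n => Or.inl (by simp)
  have := hfin.to_subtype
  obtain ⟨a, b, hab, h⟩ := Finite.exists_ne_map_eq_of_infinite
    fun n : ℕ => (⟨s (-1 + (n : ℤ) * (2 * Real.pi * I)), by
      rw [mem_preimage, mem_singleton_iff, hs.map_eq _ (hmem n), exp_add,
        exp_int_mul_two_pi_mul_I, mul_one]⟩ : f ⁻¹' {exp (-1)})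
  wlog hlt : a < b generalizing a b
  · exact this b a hab.symm h.symm (lt_of_le_of_ne (not_lt.1 hlt) hab.symm)
  have h' := hs.translate_eq hf (m := b) (n := a) (w₀ := -1) (by simp)
    (Subtype.ext_iff.1 h).symm (w := -1 - (a : ℤ) * (2 * Real.pi * I)) (by simp)
  refine ⟨b - a, by omega, ?_⟩
  convert h' using 2
  · rw [Nat.cast_sub hlt.le]
    push_cast
    ring
  · ring

/-- A punctured sheet is crossed exactly once by the loop around the puncture, so it carries a
nontrivial first homology class. Hence sheets accumulate over the puncture when `H₁` vanishes. -/
theorem IsExpLift.exists_mem_closure_sheetCore [T2Space X] (hf : IsLocalHomeomorph f)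
    (hε : 0 < ε) (hεπ : ε < Real.pi) (hs : IsExpLift f ε s)
    (hfin : (f ⁻¹' {exp (-1)}).Finite) (hH : Subsingleton (integralHomology 1 X)) :
    ∃ x, f x = 0 ∧ x ∈ closure (sheetCore s ε) := by
  classical
  by_contra! h0
  have hex := hs.exists_period hf hfin
  -- With k minimal, the loop meets the sheet of `s (-1)` only around its endpoint, not at
  -- intermediate turns.
  obtain ⟨k, hk, hmin⟩ : ∃ k : ℕ, (0 < k ∧ s (-1 + (k : ℤ) * (2 * Real.pi * I)) = s (-1)) ∧
      ∀ j : ℕ, j < k → ¬ (0 < j ∧ s (-1 + (j : ℤ) * (2 * Real.pi * I)) = s (-1)) :=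
    ⟨Nat.find hex, Nat.find_spec hex, fun j hj => Nat.find_min hex hj⟩
  obtain ⟨hk0, hks⟩ := hk
  have hk1 : (1 : ℝ) ≤ k := by exact_mod_cast hk0
  let p : ℝ → ℂ := fun τ => -1 + τ * I
  have hp : ∀ τ, p τ ∈ keyhole ε := fun τ => Or.inl (by simp [p])
  have hpc : Continuous p := by fun_prop
  let g : C(X, Circle) := ⟨sheetToCircle f s ε, hs.continuous_sheetToCircle hf hε hεπ h0⟩
  -- the value of `g` along the lifted circle
  have hg : ∀ τ : ℝ, 0 ≤ τ → τ ≤ 2 * Real.pi * k →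
      Circle.exp (2 * Real.pi * (ramp ε τ + ramp ε (τ - 2 * Real.pi * k))) = g (s (p τ)) := by
    intro τ hτ0 hτk
    obtain ⟨n, hn⟩ : ∃ n : ℤ, log (exp (p τ)) = p τ + n * (2 * Real.pi * I) :=
      exp_eq_exp_iff_exists_int.1 (exp_log (exp_ne_zero _))
    -- j counts turns: 2πj is a multiple of 2π nearest to τ.
    obtain ⟨j, rfl⟩ : ∃ j : ℤ, n = -j := ⟨-n, by simp⟩
    have hfp := hs.map_eq _ (hp τ)
    have harg : arg (f (s (p τ))) = τ - 2 * Real.pi * j := by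
      rw [hfp, ← log_im, hn]
      simp [p]
      ring
    have hpi := abs_le.1 (abs_arg_le_pi (f (s (p τ))))
    rw [harg] at hpi
    have hπ := Real.pi_pos
    have hjlo : 0 ≤ j := by
      have : (-1 : ℝ) < j := by nlinarith
      exact_mod_cast Int.lt_iff_add_one_le.1 (by exact_mod_cast this : (-1 : ℤ) < j)
    have hjhi : j ≤ k := by
      have : (j : ℝ) < k + 1 := by nlinarith
      exact Int.lt_add_one_iff.1 (by exact_mod_cast this)
    lift j to ℕ using hjlo
    have hjk : j ≤ k := by exact_mod_cast hjhi
    rw [Int.cast_natCast] at harg hpi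
    -- membership in the sheet
    have hsheet : s (p τ) ∈ sheet f s ε ↔ |τ - 2 * Real.pi * j| < ε ∧
        s (-1 + (j : ℤ) * (2 * Real.pi * I)) = s (-1) := by
      have hiff : s (log (f (s (p τ)))) = s (p τ) ↔
          s (-1 + (j : ℤ) * (2 * Real.pi * I)) = s (-1) := by
        rw [hfp, hn]
        have hre : (p τ + ((-(j : ℤ) : ℤ) : ℂ) * (2 * Real.pi * I)).re < 0 := by simp [p]
        constructor <;> intro h
        · have := hs.translate_eq hf (m := (j : ℤ)) (n := 0) hre (by
            rw [Int.cast_zero, zero_mul, add_zero, h]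
            congr 1
            push_cast
            ring) (w := -1) (by simp)
          simpa using this
        · have := hs.translate_eq hf (m := (j : ℤ)) (n := 0) (w₀ := -1) (by simp)
            (by rw [h]; simp) hre
          rw [Int.cast_zero, zero_mul, add_zero] at this
          rw [← this]
          congr 1
          push_cast
          ring
      rw [sheet, mem_ofPred_eq, hiff, sector, mem_ofPred_eq, harg, mem_slitPlane_iff_arg, harg]
      refine and_congr_left fun _ => and_iff_right_of_imp fun h => ⟨?_, ?_⟩
      · exact ((abs_lt.1 (h.trans hεπ)).2).ne
      · rw [hfp]; exact exp_ne_zero _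
    have hg_in : s (p τ) ∈ sheet f s ε →
        g (s (p τ)) = Circle.exp (2 * Real.pi * ramp ε (τ - 2 * Real.pi * j)) := fun h => by
      change sheetToCircle f s ε _ = _
      rw [sheetToCircle, if_pos h, harg]
    have hg_out : s (p τ) ∉ sheet f s ε → g (s (p τ)) = 1 := fun h => if_neg h
    have hg_eq : s (-1 + (j : ℤ) * (2 * Real.pi * I)) = s (-1) →
        g (s (p τ)) = Circle.exp (2 * Real.pi * ramp ε (τ - 2 * Real.pi * j)) := fun h => by
      by_cases hlt : |τ - 2 * Real.pi * j| < ε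
      · exact hg_in (hsheet.2 ⟨hlt, h⟩)
      · rw [hg_out fun h' => hlt (hsheet.1 h').1, circle_exp_two_pi_mul_ramp hε (by linarith)]
    rcases Nat.eq_zero_or_pos j with rfl | hj0
    · rw [hg_eq (by simp), ramp_of_le hε (θ := τ - 2 * Real.pi * k)]
      · simp
      · simp only [Nat.cast_zero, mul_zero, sub_zero] at hpi
        nlinarith
    rcases hjk.lt_or_eq with hlt | rfl
    · rw [hg_out fun h => hmin j hlt ⟨hj0, (hsheet.1 h).2⟩]
      have h1 : (1 : ℝ) ≤ j := by exact_mod_cast hj0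
      have h2 : (j : ℝ) + 1 ≤ k := by exact_mod_cast hlt
      rw [ramp_of_ge hε (θ := τ) (by nlinarith), ramp_of_le hε (by nlinarith)]
      simp
    · rw [hg_eq hks, ramp_of_ge hε (θ := τ) (by nlinarith), mul_add, Circle.exp_add]
      simp
  have hsp : Continuous fun t : unitInterval => s (p (2 * Real.pi * k * t)) :=
    hs.continuousOn.comp_continuous (by fun_prop) fun t => hp _
  have hr := continuous_ramp ε
  let u : C(unitInterval, ℝ) := ⟨fun t => 2 * Real.pi * (ramp ε (2 * Real.pi * k * t) +
    ramp ε (2 * Real.pi * k * t - 2 * Real.pi * k)), by fun_prop⟩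
  have hu := circle_lift_eq_of_subsingleton_homology hH g ⟨_, hsp⟩ ?_ u fun t => ?_
  -- The loop starts and ends in the middle of the sheet, so its single crossing is split into two
  -- halves: u goes from π to 3π.
  · have e0 : u 0 = 2 * Real.pi * (1 / 2) := by
      simp only [u, ContinuousMap.coe_mk, Set.Icc.coe_zero, mul_zero, zero_sub, ramp_zero]
      rw [ramp_of_le hε (by nlinarith [Real.pi_pos]), add_zero]
    have e1 : u 1 = 2 * Real.pi * (1 + 1 / 2) := by
      simp only [u, ContinuousMap.coe_mk, Set.Icc.coe_one, mul_one, sub_self, ramp_zero]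
      rw [ramp_of_ge hε (by nlinarith [Real.pi_pos])]
    rw [e0, e1] at hu
    nlinarith [Real.pi_pos]
  · simp only [ContinuousMap.coe_mk, Set.Icc.coe_zero, Set.Icc.coe_one, mul_zero, mul_one]
    have h1 : p 0 = -1 := by simp [p]
    have h2 : p (2 * Real.pi * k) = -1 + (k : ℤ) * (2 * Real.pi * I) := by
      simp only [p]
      push_cast
      ring
    rw [h1, h2, hks]
  · have hk' : 0 ≤ 2 * Real.pi * k := by positivity
    exact hg _ (mul_nonneg hk' t.2.1) (mul_le_of_le_one_right hk' t.2.2)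

/-- The fibre over the puncture is at least as large as the fibre over the base point. -/
theorem IsCoveringMapOn.encard_fiber_le_of_keyhole [T2Space X] (hf : IsLocalHomeomorph f)
    {S : Set ℂ} (hc : IsCoveringMapOn f S) (hε : 0 < ε) (hεπ : ε < Real.pi)
    (hS : ∀ w ∈ keyhole ε, exp w ∈ S) (hfin : (f ⁻¹' {exp (-1)}).Finite)
    (hH : Subsingleton (integralHomology 1 X)) :
    (f ⁻¹' {exp (-1)}).encard ≤ (f ⁻¹' {0}).encard := by
  choose! s hs hsy using fun (y : X) (hy : f y = exp (-1)) => hc.exists_isExpLift hS hy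
  choose! x hx0 hx using fun (y : X) (hy : f y = exp (-1)) =>
    (hs y hy).exists_mem_closure_sheetCore hf hε hεπ hfin hH
  refine encard_le_encard_of_injOn (f := x) (fun y hy => hx0 y hy) fun y hy y' hy' h => ?_
  rw [← hsy y hy, ← hsy y' hy']
  exact (hs y hy).eq_of_mem_closure hf hε (hs y' hy') (hx0 y hy) (hx y hy) (h ▸ hx y' hy')

end

/-! ### Fibre cardinality of local homeomorphisms -/

section

variable {X Y : Type*} [TopologicalSpace X] [TopologicalSpace Y] {f : X → Y}

theorem IsLocalHomeomorph.eventually_encard_le [T2Space X] (hf : IsLocalHomeomorph f) {p : Y}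
    {T V : Set X} (hT : T.Finite) (hTp : T ⊆ f ⁻¹' {p}) (hV : IsOpen V) (hTV : T ⊆ V) :
    ∀ᶠ z in 𝓝 p, T.encard ≤ (f ⁻¹' {z} ∩ V).encard := by
  obtain ⟨U, hU, hdisj⟩ := hT.t2_separation
  have h : ∀ x ∈ T, ∀ᶠ z in 𝓝 p, z ∈ f '' (U x ∩ V) := fun x hx => by
    have := hf.isOpenMap.image_mem_nhds (((hU x).2.inter hV).mem_nhds ⟨(hU x).1, hTV hx⟩)
    rwa [show f x = p from hTp hx] at this
  filter_upwards [(eventually_all_finite hT).2 h] with z hz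
  choose! y hy hyz using hz
  refine encard_le_encard_of_injOn (f := y) (fun x hx => ⟨hyz x hx, (hy x hx).2⟩)
    fun x hx x' hx' hxx' => ?_
  by_contra hne
  exact disjoint_left.1 (hdisj hx hx' hne) (hy x hx).1 (hxx' ▸ (hy x' hx').1)

/-- The fibres of a local homeomorphism over a dense set bound the size of all fibres. -/
theorem IsLocalHomeomorph.encard_fiber_le_of_dense [T2Space X] (hf : IsLocalHomeomorph f) {S : Set Y}
    (hS : Dense S) {n : ℕ} (h : ∀ z ∈ S, (f ⁻¹' {z}).encard ≤ n) (p : Y) :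
    (f ⁻¹' {p}).encard ≤ n := by
  by_contra! hlt
  obtain ⟨T, hTp, hT⟩ := exists_subset_encard_eq (k := ((n + 1 : ℕ) : ℕ∞))
    (s := f ⁻¹' {p}) (by push_cast; exact Order.add_one_le_of_lt hlt)
  obtain ⟨z, hzS, hz⟩ := hS.exists_mem_open isOpen_interior
    ⟨p, mem_interior_iff_mem_nhds.2 (hf.eventually_encard_le (finite_of_encard_eq_coe hT) hTp
      isOpen_univ (subset_univ T))⟩
  have h1 := interior_subset hz
  rw [mem_ofPred_eq, inter_univ, hT] at h1
  have h2 := h1.trans (h z hzS)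
  norm_cast at h2
  omega

/-- A local homeomorphism all of whose fibres have the same finite cardinality is a covering. -/
theorem IsLocalHomeomorph.isCoveringMap_of_encard_fiber_eq [T2Space X] (hf : IsLocalHomeomorph f) {n : ℕ}
    (h : ∀ z, (f ⁻¹' {z}).encard = n) : IsCoveringMap f := by
  have hfin : ∀ z, (f ⁻¹' {z}).Finite := fun z => finite_of_encard_eq_coe (h z)
  -- If C misses the fibre over p, nearby fibres already have n points outside C, hence none in C.
  have hcl : IsClosedMap f := fun C hC => by
    rw [← isOpen_compl_iff, isOpen_iff_mem_nhds]
    intro p hp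
    have hsub : f ⁻¹' {p} ⊆ Cᶜ := fun x hx hxC => hp ⟨x, hxC, hx⟩
    filter_upwards [hf.eventually_encard_le (hfin p) subset_rfl hC.isOpen_compl hsub] with z hz
    rintro ⟨x, hxC, rfl⟩
    have heq := ((hfin (f x)).subset inter_subset_left).eq_of_subset_of_encard_le
      (inter_subset_left (t := Cᶜ)) (by rwa [h, ← h p])
    have hx : x ∈ f ⁻¹' {f x} := rfl
    rw [← heq] at hx
    exact hx.2 hxC
  rw [isCoveringMap_iff_isCoveringMapOn_univ]
  exact hcl.isCoveringMapOn_of_isLocalHomeomorphOn (fun z _ => hfin z)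
    fun x _ => hf x

/-- A covering of a simply connected, locally path-connected space by a connected space has
one sheet. -/
theorem IsCoveringMap.encard_fiber_eq_one [ConnectedSpace X] [SimplyConnectedSpace Y]
    [LocallyPathConnectedSpace Y] (hf : IsCoveringMap f) (z : Y) : (f ⁻¹' {z}).encard = 1 := by
  obtain ⟨x₀⟩ : Nonempty X := inferInstance
  obtain ⟨s, ⟨hs0, hs⟩, -⟩ := hf.existsUnique_continuousMap_lifts (.id Y) (f x₀) x₀ rfl
  have hsf : s ∘ f = id := hf.eq_of_comp_eq (s.continuous.comp hf.continuous) continuous_id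
    (by rw [← Function.comp_assoc, hs]; rfl) x₀ hs0
  rw [encard_eq_one]
  refine ⟨s z, Subset.antisymm (fun x hx => ?_) (singleton_subset_iff.2 (congrFun hs z))⟩
  obtain rfl : f x = z := hx
  exact (congrFun hsf x).symm

end

/-! ### Normalising a puncture and conclusion -/

/-- After a similarity moving `p` to `0`, a finite set avoids the image of a keyhole. -/
theorem exists_similarity_keyhole {D : Set ℂ} (hD : D.Finite) (p : ℂ) :
    ∃ c : ℂ, c ≠ 0 ∧ ∃ ε, 0 < ε ∧ ε < Real.pi ∧
      ∀ w ∈ keyhole ε, ∀ z ∈ D, z ≠ p → c * (z - p) ≠ exp w := by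
  have hinf : (Metric.sphere (0 : ℂ) 1).Infinite := by
    refine infinite_of_injOn_mapsTo (s := Ioo (0 : ℝ) 1) (f := fun t => exp (t * I))
      (fun t ht t' ht' h => ?_) (fun t _ => by simp [norm_exp_ofReal_mul_I])
      (Ioo_infinite zero_lt_one)
    have hl : ∀ t ∈ Ioo (0 : ℝ) 1, log (exp (t * I)) = t * I := fun t ht =>
      log_exp_of_mem_strip (ε := 1) (by linarith [Real.pi_gt_three])
        (by simpa [abs_of_pos ht.1] using ht.2)
    have := congrArg log h
    simpa [hl t ht, hl t' ht'] using this
  -- A rotation that puts no point of D other than p on the positive ray from p.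
  obtain ⟨a, ha, haD⟩ := hinf.exists_notMem_finite (hD.image fun z => (‖z - p‖ : ℂ) / (z - p))
  have ha1 : ‖a‖ = 1 := by simpa using ha
  have ha0 : a ≠ 0 := norm_pos_iff.1 (by rw [ha1]; exact one_pos)
  have harg : ∀ z ∈ D, z ≠ p → arg (a * (z - p)) ≠ 0 := fun z hz hzp h => by
    refine haD ⟨z, hz, ?_⟩
    have h1 := norm_mul_exp_arg_mul_I (a * (z - p))
    rw [h, norm_mul, ha1] at h1
    simp only [one_mul, ofReal_zero, zero_mul, exp_zero, mul_one] at h1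
    rw [div_eq_iff (sub_ne_zero.2 hzp), h1]
  have hev : ∀ᶠ ε in 𝓝[>] (0 : ℝ), ∀ z ∈ D, z ≠ p →
      ε < |arg (a * (z - p))| ∧ ε < ‖z - p‖ := by
    refine (eventually_all_finite hD).2 fun z hz => ?_
    by_cases hzp : z = p
    · exact Eventually.of_forall fun _ h => absurd hzp h
    · filter_upwards [nhdsWithin_le_nhds (eventually_lt_nhds (abs_pos.2 (harg z hz hzp))),
        nhdsWithin_le_nhds (eventually_lt_nhds (norm_pos_iff.2 (sub_ne_zero.2 hzp)))]
        with ε h1 h2 _ using ⟨h1, h2⟩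
  obtain ⟨ε, hε, hεπ, hε0⟩ := (hev.and ((eventually_nhdsWithin_of_eventually_nhds
    (eventually_lt_nhds Real.pi_pos)).and eventually_mem_nhdsWithin)).exists
  have hε0 : 0 < ε := hε0
  -- Scaling by ε⁻¹ pushes these points out of the unit disc, the rotation out of the sector.
  refine ⟨(ε⁻¹ : ℝ) * a, mul_ne_zero (by simpa using hε0.ne') ha0, ε, hε0, hεπ,
    fun w hw z hz hzp h => ?_⟩
  obtain ⟨h1, h2⟩ := hε z hz hzp
  rw [mul_assoc] at h
  rcases hw with hw | hw
  · have hn : ‖(ε⁻¹ : ℝ) * (a * (z - p))‖ = Real.exp w.re := by rw [h, norm_exp]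
    rw [norm_mul, norm_mul, ha1, one_mul, norm_real, Real.norm_of_nonneg (inv_pos.2 hε0).le] at hn
    have h3 : Real.exp w.re < 1 := Real.exp_zero ▸ Real.exp_lt_exp.2 hw
    rw [← hn, inv_mul_lt_iff₀ hε0] at h3
    linarith
  · have h3 : arg (a * (z - p)) = w.im := by
      rw [← arg_real_mul _ (inv_pos.2 hε0), h, ← log_im, log_exp_of_mem_strip hεπ hw]
    rw [h3] at h1
    linarith

/-- Fibres over the punctures are at least as large as the generic fibre. -/
theorem IsCoveringMapOn.le_encard_fiber {X : Type u} [TopologicalSpace X] [T2Space X]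
    (hH : Subsingleton (integralHomology 1 X)) {f : X → ℂ} (hf : IsLocalHomeomorph f)
    {D : Set ℂ} (hD : D.Finite) (hc : IsCoveringMapOn f Dᶜ) {n : ℕ}
    (hn : ∀ z ∉ D, (f ⁻¹' {z}).encard = n) (p : ℂ) : n ≤ (f ⁻¹' {p}).encard := by
  by_cases hp : p ∈ D
  swap
  · exact (hn p hp).ge
  obtain ⟨c, hc0, ε, hε, hεπ, hk⟩ := exists_similarity_keyhole hD p
  let e : ℂ ≃ₜ ℂ := (Homeomorph.subRight p).trans (Homeomorph.mulLeft₀ c hc0)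
  have he : ∀ z, e z = c * (z - p) := fun z => rfl
  have hS : ∀ w ∈ keyhole ε, e.symm (exp w) ∉ D := fun w hw hz => by
    have h1 : e (e.symm (exp w)) = exp w := e.apply_symm_apply _
    rw [he] at h1
    refine hk w hw _ hz (fun h => ?_) h1
    rw [h, sub_self, mul_zero] at h1
    exact exp_ne_zero w h1.symm
  have hfib : ∀ z, (e ∘ f) ⁻¹' {z} = f ⁻¹' {e.symm z} := fun z => by
    ext x
    simp [e.eq_symm_apply]
  have hb := hn _ (hS _ (neg_one_mem_keyhole ε))
  have h0 : e.symm 0 = p := by rw [e.symm_apply_eq, he, sub_self, mul_zero]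
  have h := (hc.homeomorph_comp e).encard_fiber_le_of_keyhole
    (e.isLocalHomeomorph.comp hf) hε hεπ (fun w hw => ?_)
    (by rw [hfib]; exact finite_of_encard_eq_coe hb) hH
  · rwa [hfib, hfib, hb, h0] at h
  · exact hS w hw

/-- A connected Hausdorff space with vanishing first homology that is étale over the plane and
finitely sheeted off a finite set has one sheet. -/
theorem IsCoveringMapOn.eq_one_of_subsingleton_homology {X : Type u} [TopologicalSpace X]
    [T2Space X] [ConnectedSpace X] (hH : Subsingleton (integralHomology 1 X)) {f : X → ℂ}
    (hf : IsLocalHomeomorph f) {D : Set ℂ} (hD : D.Finite) (hc : IsCoveringMapOn f Dᶜ) {n : ℕ}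
    (hn : ∀ z ∉ D, (f ⁻¹' {z}).encard = n) : n = 1 := by
  have hdense : Dense Dᶜ := hD.countable.dense_compl ℝ
  have hfib : ∀ p, (f ⁻¹' {p}).encard = n := fun p =>
    le_antisymm (hf.encard_fiber_le_of_dense hdense (fun z hz => (hn z hz).le) p)
      (hc.le_encard_fiber hH hf hD hn p)
  have h := (hf.isCoveringMap_of_encard_fiber_eq hfib).encard_fiber_eq_one 0
  rw [hfib] at h
  exact_mod_cast h

theorem mainTheorem7 {X : Type u} [TopologicalSpace X] [T2Space X] [ConnectedSpace X]
    [ChartedSpace (EuclideanSpace ℝ (Fin 2)) X] [IsManifold (𝓡 2) ∞ X]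
    (hH : Subsingleton (integralHomology 1 X))
    (F : X → EuclideanSpace ℝ (Fin 2)) (hF : IsLocalDiffeomorph (𝓡 2) (𝓡 2) ∞ F)
    (D : Set (EuclideanSpace ℝ (Fin 2))) (hD : D.Finite) (d : ℕ∞)
    (hd : IsSheetedCover (Dᶜ.restrictPreimage F) d) :
    d = 1 ∨ d = ⊤ := by
  obtain ⟨hcov, hfib⟩ := hd
  induction d using ENat.recTopCoe with
  | top => exact Or.inr rfl
  | coe n =>
    left
    let e : EuclideanSpace ℝ (Fin 2) ≃ₜ ℂ :=
      Complex.orthonormalBasisOneI.repr.symm.toHomeomorph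
    have hFl : IsLocalHomeomorph F := hF.isLocalHomeomorph
    have hopen : IsOpen Dᶜ := hD.isClosed.isOpen_compl
    have hc : IsCoveringMapOn F Dᶜ :=
      .of_isCoveringMap_restrictPreimage _ hopen (hopen.preimage hFl.continuous) hcov
    have hc' : IsCoveringMapOn (e ∘ F) (e '' D)ᶜ := by
      have := hc.homeomorph_comp e
      rwa [preimage_compl, ← e.image_eq_preimage_symm] at this
    have hn : ∀ z ∉ e '' D, ((e ∘ F) ⁻¹' {z}).encard = n := fun z hz => by
      have hzD : e.symm z ∈ Dᶜ := fun h => hz ⟨_, h, e.apply_symm_apply z⟩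
      rw [← hfib ⟨e.symm z, hzD⟩, ← Subtype.val_injective.encard_image]
      congr 1
      ext x
      simp only [mem_preimage, mem_singleton_iff, Function.comp_apply, mem_image, Subtype.exists,
        exists_and_right, exists_eq_right, ← e.eq_symm_apply, Subtype.ext_iff,
        restrictPreimage_coe]
      exact ⟨fun h => ⟨by rwa [h], h⟩, fun ⟨_, h⟩ => h⟩
    have := hc'.eq_one_of_subsingleton_homology hH (e.isLocalHomeomorph.comp hFl) (hD.image e) hn
    exact_mod_cast this
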